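/- Write $e(x)=e^{2\pi i x}$. For real $\gamma,\kappa$, let $\psi(r,\gamma,\kappa)$ denote the meromorphic continuation to all $r\in\mathbb{C}$ of the series $$\psi(r,\gamma,\kappa)=\sum_{k\in\mathbb{Z},\,k>-\gamma}\frac{e((\gamma+k)\kappa)}{(\gamma+k)^r}\qquad(\operatorname{Re} r>1).$$ This continuation exists; it is holomorphic on $\mathbb{C}$ if $\kappa\notin\mathbb{Z}$ and on $\mathbb{C}\setminus\{1\}$ if $\kappa\in\mathbb{Z}$. For all $\gamma,\kappa\in\mathbb{R}$ one has, on the whole $r$-plane, $$\psi(r,\gamma,\kappa)=e(\gamma\kappa)\frac{\Gamma(1-r)}{(2\pi)^{1-r}}\Bigl\{e^{\pi i(1-r)/2}\,\psi(1-r,\kappa,-\gamma)+e^{-\pi i(1-r)/2}\,\psi(1-r,-\kappa,\gamma)\Bigr\}$$ as an identity of meromorphic functions: it holds pointwise at every $r$ with $r\notin\{1,2,3,\dots\}$ and, if $\gamma\in\mathbb{Z}$, also $r\neq 0$ (that is, wherever every factor on the right is finite); and at every point $r_0$ (with $r_0\ne 1$ if $\kappa\in\mathbb{Z}$) the right-hand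 side tends to $\psi(r_0,\gamma,\kappa)$ as $r\to r_0$, $r\neq r_0$. -/

import Mathlib

open Filter Topology

noncomputable section

namespace LerchZeta

/-- The standard notation `e(s) = exp(2πis)`. -/
def e (s : ℂ) : ℂ := Complex.exp (2 * Real.pi * Complex.I * s)

/-- `f` is the meromorphic continuation to all of `ℂ` (as a function of `r`) of the absolutely
convergent series `∑_{k ∈ ℤ, k > -γ} e((γ + k)κ) / (γ + k)^r`, `Re r > 1`. The normal form only
says that removable singularities have been removed and that `f` takes the value `0` at its poles;
it makes `f` unique. -/
structure IsLerchPsi (γ κ : ℝ) (f : ℂ → ℂ) : Prop where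
  meromorphic : MeromorphicNFOn f Set.univ
  hasSum : ∀ r : ℂ, 1 < r.re →
    HasSum (fun k : {k : ℤ // -γ < (k : ℝ)} =>
      e (((γ + (k : ℤ)) * κ : ℝ) : ℂ) / ((γ + (k : ℤ) : ℝ) : ℂ) ^ r) (f r)

/-- The function `ψ(r, γ, κ)`: the continuation described by `IsLerchPsi`. -/
def lerchPsi (r : ℂ) (γ κ : ℝ) : ℂ := Classical.epsilon (IsLerchPsi γ κ) r

end LerchZeta

end

noncomputable section

namespace LerchZeta

open Complex Set Asymptotics
open scoped Real

/-! ### Theta kernels with real characteristics -/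

/-! The one-sided series is half the sum of two two-sided series over `n + γ ≠ 0`, with weights `|n
+ γ|^(-s)` and `sgn(n + γ) |n + γ|^(-s)`. Up to a Gamma factor these are Mellin transforms of theta
kernels with characteristics `(γ, κ)`. Jacobi inversion `t ↦ 1 / t` sends `(γ, κ)` to `(-κ, γ)`
(`evenTheta_one_div`, `oddTheta_one_div`), so `WeakFEPair` supplies the continuations and a
functional equation for each parity.

Quotients of Gamma factors become `Gammaℂ (1 - r)` times a cosine (even) or a sine (odd). Under `(γ,
κ) ↦ (-γ, -κ)` one function is even and the other odd, so Euler's formula recombines them into the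
two exponential terms. The identity theorem carries everything over to `lerchPsi`. -/

/-- The kernel `∑ₙ e((n + γ)κ) exp(-π(n + γ)²t)`, in terms of the Jacobi theta function. -/
def evenTheta (γ κ t : ℝ) : ℂ :=
  cexp (-π * γ ^ 2 * t + 2 * π * I * (γ * κ)) * jacobiTheta₂ (κ + I * γ * t) (I * t)

/-- The kernel `∑ₙ (n + γ) e((n + γ)κ) exp(-π(n + γ)²t)`, in terms of the Jacobi theta function. -/
def oddTheta (γ κ t : ℝ) : ℂ :=
  cexp (-π * γ ^ 2 * t + 2 * π * I * (γ * κ)) *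
    (jacobiTheta₂' (κ + I * γ * t) (I * t) / (2 * π * I) +
      γ * jacobiTheta₂ (κ + I * γ * t) (I * t))

lemma e_neg (s : ℂ) : e (-s) = (e s)⁻¹ := by
  rw [e, e, ← Complex.exp_neg, mul_neg]

lemma e_ne_zero (s : ℂ) : e s ≠ 0 := Complex.exp_ne_zero _

lemma norm_e_ofReal (x : ℝ) : ‖e x‖ = 1 := by
  rw [e, show 2 * π * I * (x : ℂ) = ((2 * π * x : ℝ) : ℂ) * I by push_cast; ring]
  exact norm_exp_ofReal_mul_I _

lemma theta_term_eq (γ κ t : ℝ) (n : ℤ) :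
    cexp (-π * γ ^ 2 * t + 2 * π * I * (γ * κ)) * jacobiTheta₂_term n (κ + I * γ * t) (I * t) =
      e (((n + γ) * κ : ℝ) : ℂ) * rexp (-π * (n + γ) ^ 2 * t) := by
  rw [jacobiTheta₂_term, e, ofReal_exp, ← Complex.exp_add, ← Complex.exp_add]
  congr 1
  push_cast
  linear_combination (2 * π * n * γ * t + π * n ^ 2 * t) * I_sq

lemma hasSum_evenTheta (γ κ : ℝ) {t : ℝ} (ht : 0 < t) :
    HasSum (fun n : ℤ ↦ e (((n + γ) * κ : ℝ) : ℂ) * rexp (-π * (n + γ) ^ 2 * t))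
      (evenTheta γ κ t) := by
  simp_rw [← theta_term_eq]
  exact (hasSum_jacobiTheta₂_term _ (by simpa)).mul_left _

lemma hasSum_oddTheta (γ κ : ℝ) {t : ℝ} (ht : 0 < t) :
    HasSum (fun n : ℤ ↦ e (((n + γ) * κ : ℝ) : ℂ) * ((n + γ : ℝ) : ℂ) *
      rexp (-π * (n + γ) ^ 2 * t)) (oddTheta γ κ t) := by
  have h1 := hasSum_jacobiTheta₂_term (κ + I * γ * t) (τ := I * t) (by simpa)
  have h2 := hasSum_jacobiTheta₂'_term (κ + I * γ * t) (τ := I * t) (by simpa)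
  refine (((h2.div_const (2 * π * I)).add (h1.mul_left (γ : ℂ))).mul_left
    (cexp (-π * γ ^ 2 * t + 2 * π * I * (γ * κ)))).congr_fun fun n ↦ ?_
  rw [mul_right_comm, ← theta_term_eq, jacobiTheta₂'_term, mul_assoc (2 * π * I),
    mul_div_cancel_left₀ _ two_pi_I_ne_zero]
  push_cast
  ring

lemma evenTheta_neg_neg (γ κ t : ℝ) : evenTheta (-γ) (-κ) t = evenTheta γ κ t := by
  rw [evenTheta, evenTheta, ← jacobiTheta₂_neg_left]
  push_cast
  ring_nf

lemma oddTheta_neg_neg (γ κ t : ℝ) : oddTheta (-γ) (-κ) t = -oddTheta γ κ t := by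
  have h : ((-κ : ℝ) : ℂ) + I * ((-γ : ℝ) : ℂ) * t = -(κ + I * γ * t) := by push_cast; ring
  rw [oddTheta, oddTheta, h, jacobiTheta₂_neg_left, jacobiTheta₂'_neg_left]
  push_cast
  ring_nf

lemma continuousOn_evenTheta (γ κ : ℝ) : ContinuousOn (evenTheta γ κ) (Ioi 0) := by
  refine continuousOn_of_forall_continuousAt (fun x hx ↦ .mul (by fun_prop) ?_)
  exact (continuousAt_jacobiTheta₂ (κ + I * γ * x) <| by simpa).comp
    (f := fun u : ℝ ↦ (κ + I * γ * u, I * u)) (by fun_prop)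

lemma continuousOn_oddTheta (γ κ : ℝ) : ContinuousOn (oddTheta γ κ) (Ioi 0) := by
  refine continuousOn_of_forall_continuousAt (fun x hx ↦ .mul (by fun_prop) (.add ?_ ?_))
  · exact ((continuousAt_jacobiTheta₂' (κ + I * γ * x) <| by simpa).comp
      (f := fun u : ℝ ↦ (κ + I * γ * u, I * u)) (by fun_prop)).div_const _
  · exact continuousAt_const.mul ((continuousAt_jacobiTheta₂ (κ + I * γ * x) <| by simpa).comp
      (f := fun u : ℝ ↦ (κ + I * γ * u, I * u)) (by fun_prop))

/-- Both sides equal `exp(-πκ²x)`; the right side is split so as to show the prefactor of the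
kernels at `(-κ, γ)`. -/
lemma theta_exp_eq (γ κ : ℝ) {x : ℝ} (hx : 0 < x) :
    cexp (-π * γ ^ 2 * (1 / x : ℝ) + 2 * π * I * (γ * κ)) *
      cexp (-π * I * (κ + I * γ * (1 / x : ℝ)) ^ 2 / (I * (1 / x : ℝ))) =
    e ((γ * κ : ℝ) : ℂ) *
      cexp (-π * ((-κ : ℝ) : ℂ) ^ 2 * x + 2 * π * I * (((-κ : ℝ) : ℂ) * γ)) := by
  have hx' : (x : ℂ) ≠ 0 := ofReal_ne_zero.mpr hx.ne'
  rw [e, ← Complex.exp_add, ← Complex.exp_add]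
  congr 1
  push_cast
  field_simp
  linear_combination (-γ ^ 2) * I_sq

lemma theta_factor_eq {x : ℝ} (hx : 0 < x) :
    1 / (-I * (I * (1 / x : ℝ))) ^ (1 / 2 : ℂ) = ((x ^ (1 / 2 : ℝ) : ℝ) : ℂ) := by
  rw [neg_mul, ← mul_assoc, I_mul_I, neg_one_mul, neg_neg,
    show (1 / 2 : ℂ) = ((1 / 2 : ℝ) : ℂ) by push_cast; rfl, ← ofReal_cpow (by positivity),
    one_div x, Real.inv_rpow hx.le]
  push_cast
  rw [one_div, inv_inv]

lemma theta_args_eq (γ κ : ℝ) {x : ℝ} (hx : 0 < x) :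
    ((κ + I * γ * (1 / x : ℝ)) / (I * (1 / x : ℝ)) : ℂ) = γ + I * ((-κ : ℝ) : ℂ) * x ∧
      (-1 / (I * (1 / x : ℝ)) : ℂ) = I * x := by
  have hx' : (x : ℂ) ≠ 0 := ofReal_ne_zero.mpr hx.ne'
  constructor
  · push_cast
    field_simp
    linear_combination (κ * x) * I_sq
  · push_cast
    field_simp
    linear_combination -I_sq

lemma evenTheta_one_div (γ κ : ℝ) {x : ℝ} (hx : 0 < x) :
    evenTheta γ κ (1 / x) =
      e ((γ * κ : ℝ) : ℂ) * ((x ^ (1 / 2 : ℝ) : ℝ) : ℂ) * evenTheta (-κ) γ x := by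
  obtain ⟨h1, h2⟩ := theta_args_eq γ κ hx
  rw [evenTheta, jacobiTheta₂_functional_equation, h1, h2, theta_factor_eq hx, evenTheta]
  linear_combination ((x ^ (1 / 2 : ℝ) : ℝ) : ℂ) *
    jacobiTheta₂ (γ + I * ((-κ : ℝ) : ℂ) * x) (I * x) * theta_exp_eq γ κ hx

lemma oddTheta_one_div (γ κ : ℝ) {x : ℝ} (hx : 0 < x) :
    oddTheta γ κ (1 / x) =
      -I * e ((γ * κ : ℝ) : ℂ) * ((x ^ (3 / 2 : ℝ) : ℝ) : ℂ) * oddTheta (-κ) γ x := by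
  obtain ⟨h1, h2⟩ := theta_args_eq γ κ hx
  have hx' : (x : ℂ) ≠ 0 := ofReal_ne_zero.mpr hx.ne'
  have h3 : ((x ^ (3 / 2 : ℝ) : ℝ) : ℂ) = ((x ^ (1 / 2 : ℝ) : ℝ) : ℂ) * x := by
    rw [← ofReal_mul, ← Real.rpow_add_one hx.ne']
    norm_num
  have h4 : (I * (1 / x : ℝ) : ℂ)⁻¹ = -I * x := by
    push_cast
    simp [mul_comm]
  rw [oddTheta, jacobiTheta₂'_functional_equation,
    jacobiTheta₂_functional_equation (κ + I * γ * (1 / x : ℝ)), h1, h2,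
    theta_factor_eq hx, oddTheta, h3]
  set A := jacobiTheta₂ (γ + I * ((-κ : ℝ) : ℂ) * x) (I * x)
  set B := jacobiTheta₂' (γ + I * ((-κ : ℝ) : ℂ) * x) (I * x)
  set p := ((x ^ (1 / 2 : ℝ) : ℝ) : ℂ)
  have h5 := theta_exp_eq γ κ hx
  set E := cexp (-π * I * (κ + I * γ * (1 / x : ℝ)) ^ 2 / (I * (1 / x : ℝ)))
  rw [div_eq_mul_inv (_ * E), h4]
  -- The inhomogeneous term in the transformation of `jacobiTheta₂'` cancels `γ A` and leaves `-κ
  -- A`, the shift belonging to the new characteristic.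
  have h6 : (p * E * (-I * x) * (B - 2 * π * I * (κ + I * γ * (1 / x : ℝ)) * A) / (2 * π * I) +
      γ * (p * E * A)) = E * (-I * p * x * (B / (2 * π * I) + ((-κ : ℝ) : ℂ) * A)) := by
    push_cast
    have := Real.pi_ne_zero
    field_simp
    linear_combination (2 * π * A * p * E * γ) * I_sq
  rw [h6, ← mul_assoc, h5]
  ring

/-! ### Decay at infinity and the functional-equation pairs -/

/-- The constant term of `evenTheta γ κ` at infinity. -/
def thetaConst (γ : ℝ) : ℂ := if (γ : UnitAddCircle) = 0 then 1 else 0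

lemma coe_unitAddCircle_eq_zero_iff (γ : ℝ) : (γ : UnitAddCircle) = 0 ↔ ∃ m : ℤ, γ = m := by
  rw [AddCircle.coe_eq_zero_iff]
  simp [eq_comm]

lemma thetaConst_neg (γ : ℝ) : thetaConst (-γ) = thetaConst γ := by
  simp [thetaConst]

lemma thetaConst_eq_zero {γ : ℝ} (h : ∀ m : ℤ, γ ≠ m) : thetaConst γ = 0 := by
  rw [thetaConst, if_neg]
  rw [coe_unitAddCircle_eq_zero_iff]
  exact fun ⟨m, hm⟩ ↦ h m hm

lemma hasSum_evenTheta_sub_thetaConst (γ κ : ℝ) {t : ℝ} (ht : 0 < t) :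
    HasSum (fun n : ℤ ↦ if n + γ = 0 then 0 else
      e (((n + γ) * κ : ℝ) : ℂ) * rexp (-π * (n + γ) ^ 2 * t))
      (evenTheta γ κ t - thetaConst γ) := by
  have := Classical.propDecidable
  have key := hasSum_evenTheta γ κ ht
  rw [thetaConst]
  split_ifs with h
  · obtain ⟨k, rfl⟩ := (coe_unitAddCircle_eq_zero_iff γ).mp h
    have h0 := hasSum_ite_sub_hasSum key (-k)
    simpa [← Int.cast_add, add_eq_zero_iff_eq_neg, e] using h0
  · have h0 (n : ℤ) : n + γ ≠ 0 := by
      contrapose! h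
      exact (coe_unitAddCircle_eq_zero_iff γ).mpr ⟨-n, by push_cast; linarith⟩
    simpa [h0] using key

/-- The phases have modulus one, so termwise bounds reduce to `κ = 0`, where decay is exponential.
-/
lemma isBigO_evenTheta_sub (γ κ r : ℝ) :
    (evenTheta γ κ · - thetaConst γ) =O[atTop] (· ^ r : ℝ → ℝ) := by
  obtain ⟨p, hp, hp'⟩ := HurwitzKernelBounds.isBigO_atTop_F_int_zero_sub γ
  refine (IsBigO.trans (Eventually.isBigO ?_) hp').trans
    (isLittleO_exp_neg_mul_rpow_atTop hp r).isBigO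
  filter_upwards [eventually_gt_atTop 0] with t ht
  have h1 := HurwitzZeta.hasSum_int_evenKernel₀ γ ht
  have h2 : HurwitzZeta.evenKernel γ t = HurwitzKernelBounds.F_int 0 γ t := by
    simp [← (HurwitzZeta.hasSum_int_evenKernel γ ht).tsum_eq, HurwitzKernelBounds.F_int,
      HurwitzKernelBounds.f_int]
  rw [← h2, ← (hasSum_evenTheta_sub_thetaConst γ κ ht).tsum_eq]
  refine tsum_of_norm_bounded h1 fun n ↦ ?_
  split_ifs
  · simp
  · rw [norm_mul, norm_e_ofReal, one_mul, norm_real, Real.norm_of_nonneg (Real.exp_pos _).le]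

lemma isBigO_oddTheta (γ κ r : ℝ) : oddTheta γ κ =O[atTop] (· ^ r : ℝ → ℝ) := by
  obtain ⟨p, hp, hp'⟩ := HurwitzKernelBounds.isBigO_atTop_F_int_one γ
  refine (IsBigO.trans (Eventually.isBigO ?_) hp').trans
    (isLittleO_exp_neg_mul_rpow_atTop hp r).isBigO
  filter_upwards [eventually_gt_atTop 0] with t ht
  rw [← (hasSum_oddTheta γ κ ht).tsum_eq]
  refine tsum_of_norm_bounded (HurwitzKernelBounds.summable_f_int 1 γ ht).hasSum fun n ↦ ?_
  rw [norm_mul, norm_mul, norm_e_ofReal, one_mul, norm_real, norm_real,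
    Real.norm_of_nonneg (Real.exp_pos _).le, Real.norm_eq_abs, HurwitzKernelBounds.f_int, pow_one]

/-- The pair of even theta kernels exchanged by `t ↦ 1 / t`. -/
@[simps]
def evenFEPair (γ κ : ℝ) : WeakFEPair ℂ where
  f := evenTheta γ κ
  g := evenTheta (-κ) γ
  hf_int := (continuousOn_evenTheta γ κ).locallyIntegrableOn measurableSet_Ioi
  hg_int := (continuousOn_evenTheta (-κ) γ).locallyIntegrableOn measurableSet_Ioi
  k := 1 / 2
  hk := one_half_pos
  ε := e ((γ * κ : ℝ) : ℂ)
  hε := e_ne_zero _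
  f₀ := thetaConst γ
  g₀ := thetaConst (-κ)
  hf_top := isBigO_evenTheta_sub γ κ
  hg_top := isBigO_evenTheta_sub (-κ) γ
  h_feq _ hx := evenTheta_one_div γ κ hx

/-- The pair of odd theta kernels exchanged by `t ↦ 1 / t`. -/
@[simps]
def oddFEPair (γ κ : ℝ) : WeakFEPair ℂ where
  f := oddTheta γ κ
  g := oddTheta (-κ) γ
  hf_int := (continuousOn_oddTheta γ κ).locallyIntegrableOn measurableSet_Ioi
  hg_int := (continuousOn_oddTheta (-κ) γ).locallyIntegrableOn measurableSet_Ioi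
  k := 3 / 2
  hk := by norm_num
  ε := -I * e ((γ * κ : ℝ) : ℂ)
  hε := mul_ne_zero (neg_ne_zero.mpr I_ne_zero) (e_ne_zero _)
  f₀ := 0
  g₀ := 0
  hf_top r := by simpa using isBigO_oddTheta γ κ r
  hg_top r := by simpa using isBigO_oddTheta (-κ) γ r
  h_feq _ hx := oddTheta_one_div γ κ hx

lemma isStrongFEPair_oddFEPair (γ κ : ℝ) : IsStrongFEPair (oddFEPair γ κ) := ⟨rfl, rfl⟩

lemma evenFEPair_symm (γ κ : ℝ) : (evenFEPair γ κ).symm = evenFEPair (-κ) γ := by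
  unfold evenFEPair WeakFEPair.symm
  congr 1
  · exact funext fun t ↦ (evenTheta_neg_neg γ κ t).symm
  · rw [← e_neg]
    push_cast
    ring_nf
  · exact (thetaConst_neg γ).symm

lemma evenFEPair_neg_neg (γ κ : ℝ) : evenFEPair (-γ) (-κ) = evenFEPair γ κ := by
  unfold evenFEPair
  congr 1
  · exact funext (evenTheta_neg_neg γ κ)
  · exact funext (evenTheta_neg_neg (-κ) γ)
  · simp
  · exact thetaConst_neg γ
  · exact thetaConst_neg (-κ)

/-- The pairs themselves differ by signs in `g` and `ε`, but for a strong pair `Λ` is the Mellin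
transform of `f` alone. -/
lemma oddFEPair_symm_Λ (γ κ : ℝ) : (oddFEPair γ κ).symm.Λ = (oddFEPair (-κ) γ).Λ := by
  rw [(isStrongFEPair_oddFEPair γ κ).symm_Λ_eq, (isStrongFEPair_oddFEPair (-κ) γ).Λ_eq]
  rfl

lemma oddFEPair_neg_neg_Λ (γ κ : ℝ) (s : ℂ) :
    (oddFEPair (-γ) (-κ)).Λ s = -(oddFEPair γ κ).Λ s := by
  rw [(isStrongFEPair_oddFEPair (-γ) (-κ)).Λ_eq, (isStrongFEPair_oddFEPair γ κ).Λ_eq]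
  have : (oddFEPair (-γ) (-κ)).f = fun t ↦ (-1 : ℂ) • oddTheta γ κ t := by
    funext t
    simp [oddTheta_neg_neg]
  rw [this, mellin_const_smul, neg_one_smul]
  rfl

/-! ### The two-sided even and odd zeta functions -/

/-- The meromorphic continuation of `∑_{n ∈ ℤ, n + γ ≠ 0} e((n + γ)κ) / |n + γ|^s`. -/
def evenZeta (γ κ : ℝ) (s : ℂ) : ℂ :=
  ((evenFEPair γ κ).Λ₀ (s / 2) - e ((γ * κ : ℝ) : ℂ) / (1 / 2 - s / 2) * thetaConst (-κ)) *
    (Gammaℝ s)⁻¹ - thetaConst γ * (π ^ (s / 2) * (Gamma (s / 2 + 1))⁻¹)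

/-- The entire continuation of `∑_{n ∈ ℤ} sgn(n + γ) e((n + γ)κ) / |n + γ|^s`. -/
def oddZeta (γ κ : ℝ) (s : ℂ) : ℂ :=
  (oddFEPair γ κ).Λ ((s + 1) / 2) * (Gammaℝ (s + 1))⁻¹

/-- The pole of `1 / (s / 2)` cancels the zero of `1 / Gammaℝ` at `0`. The right-hand form is
entire, which makes `evenZeta` regular there. -/
lemma two_div_mul_Gammaℝ_inv {s : ℂ} (hs : s ≠ 0) :
    1 / (s / 2) * (Gammaℝ s)⁻¹ = π ^ (s / 2) * (Gamma (s / 2 + 1))⁻¹ := by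
  rw [Complex.Gamma_add_one _ (div_ne_zero hs two_ne_zero), Gammaℝ_def, neg_div, cpow_neg,
    mul_inv, mul_inv, inv_inv, one_div]
  ring

/-- At `s = 0` division by zero makes the right side `0`, while `evenZeta` equals `-thetaConst γ`.
-/
lemma evenZeta_eq {γ : ℝ} (κ : ℝ) {s : ℂ} (hs : s ≠ 0 ∨ thetaConst γ = 0) :
    evenZeta γ κ s = (evenFEPair γ κ).Λ (s / 2) * (Gammaℝ s)⁻¹ := by
  simp only [evenZeta, WeakFEPair.Λ, evenFEPair_f₀, evenFEPair_g₀, evenFEPair_k, evenFEPair_ε,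
    smul_eq_mul]
  push_cast
  rcases hs with hs | hs
  · linear_combination thetaConst γ * two_div_mul_Gammaℝ_inv hs
  · rw [hs]
    ring

lemma differentiableAt_evenZeta (γ : ℝ) {κ : ℝ} {s : ℂ} (hs : s ≠ 1 ∨ thetaConst κ = 0) :
    DifferentiableAt ℂ (evenZeta γ κ) s := by
  refine .sub (.mul (.sub ?_ ?_) differentiable_Gammaℝ_inv.differentiableAt)
    (.mul (by fun_prop) (.mul ?_ ?_))
  · exact (evenFEPair γ κ).differentiable_Λ₀.differentiableAt.comp s
      (differentiableAt_id.div_const 2)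
  · rcases hs with hs | hs
    · refine .mul (.div (by fun_prop) (by fun_prop) ?_) (by fun_prop)
      contrapose! hs
      linear_combination -2 * hs
    · simp [thetaConst_neg, hs]
  · exact (differentiableAt_id.div_const 2).const_cpow (.inl (ofReal_ne_zero.mpr Real.pi_ne_zero))
  · exact (differentiable_one_div_Gamma.comp
      ((differentiable_id.div_const 2).add_const 1)).differentiableAt

lemma differentiable_oddZeta (γ κ : ℝ) : Differentiable ℂ (oddZeta γ κ) :=
  .mul ((isStrongFEPair_oddFEPair γ κ).differentiable_Λ.comp
    ((differentiable_id.add_const 1).div_const 2))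
    (differentiable_Gammaℝ_inv.comp (differentiable_id.add_const 1))

lemma meromorphicAt_evenZeta (γ κ : ℝ) (s : ℂ) : MeromorphicAt (evenZeta γ κ) s := by
  have h1 : MeromorphicAt (fun s ↦ (evenFEPair γ κ).Λ₀ (s / 2)) s :=
    (((evenFEPair γ κ).differentiable_Λ₀.comp
      (differentiable_id.div_const 2)).analyticAt s).meromorphicAt
  have h2 : MeromorphicAt (fun s : ℂ ↦ (1 / 2 - s / 2 : ℂ)) s :=
    (Differentiable.analyticAt (by fun_prop) s).meromorphicAt
  have h3 : MeromorphicAt (fun s ↦ (Gammaℝ s)⁻¹) s :=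
    (differentiable_Gammaℝ_inv.analyticAt s).meromorphicAt
  have h4 : MeromorphicAt (fun s : ℂ ↦ (π : ℂ) ^ (s / 2) * (Gamma (s / 2 + 1))⁻¹) s := by
    refine (Differentiable.analyticAt (.mul (fun s ↦ ?_) ?_) s).meromorphicAt
    · exact (differentiableAt_id.div_const 2).const_cpow
        (.inl (ofReal_ne_zero.mpr Real.pi_ne_zero))
    · exact differentiable_one_div_Gamma.comp ((differentiable_id.div_const 2).add_const 1)
  exact ((h1.sub (((MeromorphicAt.const _ _).div h2).mul (.const _ _))).mul h3).sub
    ((MeromorphicAt.const _ _).mul h4)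

lemma evenZeta_neg_neg (γ κ : ℝ) (s : ℂ) : evenZeta (-γ) (-κ) s = evenZeta γ κ s := by
  simp [evenZeta, evenFEPair_neg_neg, thetaConst_neg]

lemma oddZeta_neg_neg (γ κ : ℝ) (s : ℂ) : oddZeta (-γ) (-κ) s = -oddZeta γ κ s := by
  simp [oddZeta, oddFEPair_neg_neg_Λ]

lemma summable_norm_e_div (γ κ : ℝ) {x : ℝ} (hx : 1 < x) :
    Summable fun n : ℤ ↦ ‖e (((n + γ) * κ : ℝ) : ℂ)‖ / |n + γ| ^ x := by
  simp_rw [norm_e_ofReal]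
  exact (Real.summable_one_div_int_add_rpow γ x).mpr hx

lemma hasSum_evenZeta (γ κ : ℝ) {s : ℂ} (hs : 1 < s.re) :
    HasSum (fun n : ℤ ↦ e (((n + γ) * κ : ℝ) : ℂ) / (|n + γ| : ℝ) ^ s) (evenZeta γ κ s) := by
  have hs0 : 0 < s.re := zero_lt_one.trans hs
  have h := hasSum_mellin_pi_mul_sq hs0
    (fun t ht ↦ hasSum_evenTheta_sub_thetaConst γ κ ht) (summable_norm_e_div γ κ hs)
  have hk : (evenFEPair γ κ).k < (s / 2).re := by
    rw [div_ofNat_re, evenFEPair_k]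
    linarith
  have hm := ((evenFEPair γ κ).hasMellin hk).2
  simp only [evenFEPair_f, evenFEPair_f₀] at hm
  rw [hm] at h
  rw [evenZeta_eq κ (.inl (ne_zero_of_re_pos hs0))]
  refine (h.mul_right (Gammaℝ s)⁻¹).congr_fun fun n ↦ ?_
  have := Gammaℝ_ne_zero_of_re_pos hs0
  field_simp

lemma hasSum_oddZeta (γ κ : ℝ) {s : ℂ} (hs : 1 < s.re) :
    HasSum (fun n : ℤ ↦ e (((n + γ) * κ : ℝ) : ℂ) * SignType.sign (n + γ : ℝ) /
      (|n + γ| : ℝ) ^ s) (oddZeta γ κ s) := by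
  have hs0 : 0 < s.re := zero_lt_one.trans hs
  have h := hasSum_mellin_pi_mul_sq' hs0
    (fun t ht ↦ hasSum_oddTheta γ κ ht) (summable_norm_e_div γ κ hs)
  rw [oddZeta, (isStrongFEPair_oddFEPair γ κ).Λ_eq]
  refine (h.mul_right (Gammaℝ (s + 1))⁻¹).congr_fun fun n ↦ ?_
  have : Gammaℝ (s + 1) ≠ 0 := Gammaℝ_ne_zero_of_re_pos (by rw [add_re, one_re]; linarith)
  field_simp

lemma evenZeta_functional_equation {γ : ℝ} (κ : ℝ) {r : ℂ} (hr : ∀ n : ℕ, r ≠ n + 1)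
    (hr0 : r ≠ 0 ∨ thetaConst γ = 0) :
    evenZeta γ κ r = e ((γ * κ : ℝ) : ℂ) * Gammaℂ (1 - r) * cos (π * (1 - r) / 2) *
      evenZeta (-κ) γ (1 - r) := by
  have h1 : 1 - r ≠ 0 := sub_ne_zero.mpr (by simpa using (hr 0).symm)
  have hs (n : ℕ) : 1 - r ≠ -n := fun h ↦ hr n (by linear_combination -h)
  -- This trades `1 / Gammaℝ r` for `Gammaℂ (1 - r) cos(π(1 - r)/2) / Gammaℝ (1 - r)`.
  have h2 := inv_Gammaℝ_one_sub hs
  rw [sub_sub_cancel] at h2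
  have h3 := (evenFEPair γ κ).functional_equation ((1 - r) / 2)
  rw [evenFEPair_symm, evenFEPair_k, evenFEPair_ε, smul_eq_mul,
    show (((1 / 2 : ℝ) : ℂ) - (1 - r) / 2) = r / 2 by push_cast; ring] at h3
  rw [evenZeta_eq κ hr0, evenZeta_eq γ (.inl h1), h2, h3]
  ring

lemma oddZeta_functional_equation (γ κ : ℝ) {r : ℂ} (hr : ∀ n : ℕ, r ≠ n + 1) :
    oddZeta γ κ r = -I * e ((γ * κ : ℝ) : ℂ) * Gammaℂ (1 - r) * sin (π * (1 - r) / 2) *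
      oddZeta (-κ) γ (1 - r) := by
  have hs (n : ℕ) : 1 - r ≠ -n := fun h ↦ hr n (by linear_combination -h)
  have h2 := inv_Gammaℝ_two_sub hs
  rw [show 2 - (1 - r) = r + 1 by ring] at h2
  have h3 := (oddFEPair γ κ).functional_equation ((1 - r + 1) / 2)
  rw [oddFEPair_symm_Λ, oddFEPair_k, oddFEPair_ε, smul_eq_mul,
    show (((3 / 2 : ℝ) : ℂ) - (1 - r + 1) / 2) = (r + 1) / 2 by push_cast; ring] at h3
  rw [oddZeta, oddZeta, h2, h3]
  ring

/-! ### The one-sided function -/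

/-- Half the sum of the even and odd zeta functions: the Lerch function, up to its value at a pole
at `1`. -/
def lerchZeta (γ κ : ℝ) (s : ℂ) : ℂ := (evenZeta γ κ s + oddZeta γ κ s) / 2

lemma hasSum_lerchZeta (γ κ : ℝ) {s : ℂ} (hs : 1 < s.re) :
    HasSum (fun k : {k : ℤ // -γ < (k : ℝ)} =>
      e (((γ + (k : ℤ)) * κ : ℝ) : ℂ) / ((γ + (k : ℤ) : ℝ) : ℂ) ^ s) (lerchZeta γ κ s) := by
  have hs0 : s ≠ 0 := ne_zero_of_re_pos (zero_lt_one.trans hs)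
  have h := ((hasSum_evenZeta γ κ hs).add (hasSum_oddZeta γ κ hs)).div_const 2
  refine (hasSum_subtype_iff_indicator (s := {k : ℤ | -γ < (k : ℝ)})
    (f := fun k : ℤ ↦ e (((γ + k) * κ : ℝ) : ℂ) / ((γ + k : ℝ) : ℂ) ^ s)).mpr
    (h.congr_fun fun n ↦ ?_)
  simp only [indicator_apply, mem_ofPred_eq]
  rcases lt_trichotomy (n + γ : ℝ) 0 with hn | hn | hn
  · rw [if_neg (by linarith), sign_neg hn, SignType.coe_neg_one]
    ring
  -- A vanishing `n + γ` contributes nothing, since `0 ^ s = 0` and division by zero gives `0`.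
  · rw [if_neg (by linarith), hn]
    simp [zero_cpow hs0]
  · rw [if_pos (by linarith), sign_pos hn, abs_of_pos hn, add_comm γ, SignType.coe_one]
    ring

lemma analyticAt_lerchZeta (γ : ℝ) {κ : ℝ} {s : ℂ} (hs : s ≠ 1 ∨ ∀ m : ℤ, κ ≠ m) :
    AnalyticAt ℂ (lerchZeta γ κ) s := by
  rw [analyticAt_iff_eventually_differentiableAt]
  have key : ∀ᶠ z in 𝓝 s, z ≠ 1 ∨ thetaConst κ = 0 := by
    rcases hs with hs | hs
    · filter_upwards [isOpen_ne.mem_nhds hs] with z hz using .inl hz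
    · exact .of_forall fun _ ↦ .inr (thetaConst_eq_zero hs)
  filter_upwards [key] with z hz
  exact ((differentiableAt_evenZeta γ hz).add
    (differentiable_oddZeta γ κ).differentiableAt).div_const 2

lemma meromorphicOn_lerchZeta (γ κ : ℝ) : MeromorphicOn (lerchZeta γ κ) univ := fun s _ ↦
  ((meromorphicAt_evenZeta γ κ s).add
    ((differentiable_oddZeta γ κ).analyticAt s).meromorphicAt).div (MeromorphicAt.const 2 s)

lemma lerchZeta_functional_equation {γ : ℝ} (κ : ℝ) {r : ℂ} (hr : ∀ n : ℕ, r ≠ n + 1)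
    (hr0 : r ≠ 0 ∨ ∀ m : ℤ, γ ≠ m) :
    lerchZeta γ κ r = e ((γ * κ : ℝ) : ℂ) * (Gamma (1 - r) / ((2 * π : ℝ) : ℂ) ^ (1 - r)) *
      (cexp (π * I * (1 - r) / 2) * lerchZeta κ (-γ) (1 - r) +
        cexp (-(π * I * (1 - r) / 2)) * lerchZeta (-κ) γ (1 - r)) := by
  have h1 := evenZeta_neg_neg (-κ) γ (1 - r)
  have h2 := oddZeta_neg_neg (-κ) γ (1 - r)
  rw [neg_neg] at h1 h2
  have hc : cexp (π * I * (1 - r) / 2) = cos (π * (1 - r) / 2) + sin (π * (1 - r) / 2) * I := by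
    rw [← Complex.exp_mul_I]
    ring_nf
  have hc' : cexp (-(π * I * (1 - r) / 2)) =
      cos (π * (1 - r) / 2) - sin (π * (1 - r) / 2) * I := by
    rw [show -(π * I * (1 - r) / 2) = -(π * (1 - r) / 2) * I by ring, Complex.exp_mul_I,
      Complex.cos_neg, Complex.sin_neg, neg_mul, ← sub_eq_add_neg]
  -- With `C`, `S` the cosine and sine and `E`, `O` the dual even and odd values, `(C + iS)(E - O) +
  -- (C - iS)(E + O) = 2(CE - iSO)`.
  rw [lerchZeta, lerchZeta, lerchZeta, h1, h2, hc, hc', oddZeta_functional_equation γ κ hr,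
    evenZeta_functional_equation κ hr (hr0.imp_right thetaConst_eq_zero), Gammaℂ_def, cpow_neg]
  push_cast
  ring

/-! ### Uniqueness of the continuation and transfer to `lerchPsi` -/

/-- The normal form of `lerchZeta` is the continuation of the Lerch series. -/
lemma isLerchPsi_toMeromorphicNFOn (γ κ : ℝ) :
    IsLerchPsi γ κ (toMeromorphicNFOn (lerchZeta γ κ) univ) where
  meromorphic := meromorphicNFOn_toMeromorphicNFOn _ _
  hasSum r hr := by
    have hr1 : r ≠ 1 := by
      rintro rfl
      simp at hr
    rw [toMeromorphicNFOn_eq_toMeromorphicNFAt (meromorphicOn_lerchZeta γ κ) (mem_univ r),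
      toMeromorphicNFAt_eq_self.mpr (analyticAt_lerchZeta γ (.inl hr1)).meromorphicNFAt]
    exact hasSum_lerchZeta γ κ hr

/-- Meromorphic functions in normal form on `ℂ` that agree near a point are equal. -/
lemma eq_of_meromorphicNFOn_of_eventuallyEq {f g : ℂ → ℂ} (hf : MeromorphicNFOn f univ)
    (hg : MeromorphicNFOn g univ) {z : ℂ} (h : f =ᶠ[𝓝 z] g) : f = g := by
  have hfg : MeromorphicOn (f - g) univ := hf.meromorphicOn.sub hg.meromorphicOn
  have hz : meromorphicOrderAt (f - g) z = ⊤ := by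
    rw [meromorphicOrderAt_eq_top_iff]
    filter_upwards [h.filter_mono nhdsWithin_le_nhds] with w hw
    simp [hw]
  funext w
  -- Identity theorem: infinite order at one point spreads over the connected plane.
  have hw : meromorphicOrderAt (f - g) w = ⊤ := by
    by_contra hne
    exact hfg.meromorphicOrderAt_ne_top_of_isPreconnected isPreconnected_univ (mem_univ w)
      (mem_univ z) hne hz
  rw [meromorphicOrderAt_eq_top_iff] at hw
  refine ((hf (mem_univ w)).eventuallyEq_nhdsNE_iff_eventuallyEq_nhds (hg (mem_univ w))).mp ?_
    |>.eq_of_nhds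
  filter_upwards [hw] with v hv
  exact sub_eq_zero.mp hv

lemma IsLerchPsi.unique {γ κ : ℝ} {f g : ℂ → ℂ} (hf : IsLerchPsi γ κ f)
    (hg : IsLerchPsi γ κ g) : f = g := by
  refine eq_of_meromorphicNFOn_of_eventuallyEq hf.meromorphic hg.meromorphic (z := 2) ?_
  have : {s : ℂ | 1 < s.re} ∈ 𝓝 (2 : ℂ) :=
    (isOpen_lt continuous_const continuous_re).mem_nhds (by simp)
  filter_upwards [this] with s hs using (hf.hasSum s hs).unique (hg.hasSum s hs)

lemma isLerchPsi_lerchPsi (γ κ : ℝ) : IsLerchPsi γ κ (fun r ↦ lerchPsi r γ κ) :=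
  Classical.epsilon_spec ⟨_, isLerchPsi_toMeromorphicNFOn γ κ⟩

lemma lerchPsi_eventuallyEq (γ : ℝ) {κ : ℝ} {r : ℂ} (hr : r ≠ 1 ∨ ∀ m : ℤ, κ ≠ m) :
    (fun r ↦ lerchPsi r γ κ) =ᶠ[𝓝 r] lerchZeta γ κ := by
  rw [(isLerchPsi_lerchPsi γ κ).unique (isLerchPsi_toMeromorphicNFOn γ κ)]
  refine (toMeromorphicNFOn_eq_toMeromorphicNFAt_on_nhds (meromorphicOn_lerchZeta γ κ)
    (mem_univ r)).trans ?_
  rw [toMeromorphicNFAt_eq_self.mpr (analyticAt_lerchZeta γ hr).meromorphicNFAt]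

lemma lerchPsi_eq (γ : ℝ) {κ : ℝ} {r : ℂ} (hr : r ≠ 1 ∨ ∀ m : ℤ, κ ≠ m) :
    lerchPsi r γ κ = lerchZeta γ κ r :=
  (lerchPsi_eventuallyEq γ hr).eq_of_nhds

lemma analyticAt_lerchPsi (γ : ℝ) {κ : ℝ} {r : ℂ} (hr : r ≠ 1 ∨ ∀ m : ℤ, κ ≠ m) :
    AnalyticAt ℂ (fun r ↦ lerchPsi r γ κ) r :=
  (analyticAt_lerchZeta γ hr).congr (lerchPsi_eventuallyEq γ hr).symm

lemma lerchPsi_functional_equation {γ : ℝ} (κ : ℝ) {r : ℂ} (hr : ∀ n : ℕ, r ≠ n + 1)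
    (hr0 : r ≠ 0 ∨ ∀ m : ℤ, γ ≠ m) :
    lerchPsi r γ κ = e ((γ * κ : ℝ) : ℂ) * (Gamma (1 - r) / ((2 * π : ℝ) : ℂ) ^ (1 - r)) *
      (cexp (π * I * (1 - r) / 2) * lerchPsi (1 - r) κ (-γ) +
        cexp (-(π * I * (1 - r) / 2)) * lerchPsi (1 - r) (-κ) γ) := by
  have h1 : r ≠ 1 := by simpa using hr 0
  have h2 : 1 - r ≠ 1 ∨ ∀ m : ℤ, γ ≠ m := by simpa using hr0
  have h3 : 1 - r ≠ 1 ∨ ∀ m : ℤ, -γ ≠ m := by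
    refine h2.imp_right fun h m hm ↦ h (-m) ?_
    push_cast
    linarith
  rw [lerchPsi_eq γ (.inl h1), lerchPsi_eq κ h3, lerchPsi_eq (-κ) h2,
    lerchZeta_functional_equation κ hr hr0]

lemma eventually_nhdsNE_ne_intCast (r₀ : ℂ) : ∀ᶠ r : ℂ in 𝓝[≠] r₀, ∀ n : ℤ, r ≠ n := by
  have hc : IsClosed ((fun n : ℤ ↦ (n : ℂ)) '' {n | (n : ℂ) ≠ r₀}) :=
    Complex.isClosedEmbedding_intCast.isClosedMap _ (isClosed_discrete _)
  filter_upwards [nhdsWithin_le_nhds (hc.isOpen_compl.mem_nhds (x := r₀) (by simp)),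
    self_mem_nhdsWithin] with r hr hne n hn
  exact hr ⟨n, by simpa [← hn] using hne, hn.symm⟩

end LerchZeta

end

/-- For all real `γ`, `κ`: the function `r ↦ ψ(r, γ, κ)` is the meromorphic continuation of its
series, with no pole except possibly `r = 1` when `κ` is an integer. The functional equation holds
at every point `r` at which the factors on its right-hand side are all finite (`Γ(1 - r)` has its
poles at `r = 1, 2, …`, and `ψ(1 - r, κ, -γ)`, `ψ(1 - r, -κ, γ)` have theirs at `r = 0` when `γ` is
an integer), and at the other points, in the limit, wherever the left-hand side is finite. -/
theorem proposition1 (γ κ : ℝ) :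
    LerchZeta.IsLerchPsi γ κ (fun r => LerchZeta.lerchPsi r γ κ) ∧
    (∀ r : ℂ, (r ≠ 1 ∨ ∀ m : ℤ, κ ≠ m) →
      AnalyticAt ℂ (fun r => LerchZeta.lerchPsi r γ κ) r) ∧
    (∀ r : ℂ, (∀ n : ℕ, r ≠ n + 1) → (r ≠ 0 ∨ ∀ m : ℤ, γ ≠ m) →
      LerchZeta.lerchPsi r γ κ =
        LerchZeta.e ((γ * κ : ℝ) : ℂ) *
          (Complex.Gamma (1 - r) / ((2 * Real.pi : ℝ) : ℂ) ^ (1 - r)) *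
          (Complex.exp (Real.pi * Complex.I * (1 - r) / 2) *
              LerchZeta.lerchPsi (1 - r) κ (-γ) +
            Complex.exp (-(Real.pi * Complex.I * (1 - r) / 2)) *
              LerchZeta.lerchPsi (1 - r) (-κ) γ)) ∧
    (∀ r₀ : ℂ, (r₀ ≠ 1 ∨ ∀ m : ℤ, κ ≠ m) →
      Tendsto (fun r : ℂ =>
        LerchZeta.e ((γ * κ : ℝ) : ℂ) *
          (Complex.Gamma (1 - r) / ((2 * Real.pi : ℝ) : ℂ) ^ (1 - r)) *
          (Complex.exp (Real.pi * Complex.I * (1 - r) / 2) *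
              LerchZeta.lerchPsi (1 - r) κ (-γ) +
            Complex.exp (-(Real.pi * Complex.I * (1 - r) / 2)) *
              LerchZeta.lerchPsi (1 - r) (-κ) γ))
        (𝓝[≠] r₀) (𝓝 (LerchZeta.lerchPsi r₀ γ κ))) := by
  refine ⟨LerchZeta.isLerchPsi_lerchPsi γ κ, fun r hr ↦ LerchZeta.analyticAt_lerchPsi γ hr,
    fun r hr hr0 ↦ LerchZeta.lerchPsi_functional_equation κ hr hr0, fun r₀ hr₀ ↦ ?_⟩
  -- The left side is continuous at `r₀`, and the identity holds off the integers, hence throughout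
  -- a punctured neighbourhood.
  have hcont := (LerchZeta.analyticAt_lerchPsi γ hr₀).continuousAt.tendsto
  refine (hcont.mono_left nhdsWithin_le_nhds).congr' ?_
  filter_upwards [LerchZeta.eventually_nhdsNE_ne_intCast r₀] with r hr
  exact LerchZeta.lerchPsi_functional_equation κ (fun n ↦ by exact_mod_cast hr (n + 1))
    (.inl (by exact_mod_cast hr 0))
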